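/- There is an absolute constant $C > 0$ such that the following holds. Let $p$ be a prime, let $G$ and $H$ be finite-dimensional vector spaces over $\mathbb{F}_p$, and let $A \subseteq G \times H$ be a transverse set, that is, for each $x \in G$ the column $\{y \in H \colon (x,y) \in A\}$ is a non-empty linear subspace of $H$, and for each $y \in H$ the row $\{x \in G \colon (x,y) \in A\}$ is a non-empty linear subspace of $G$. Let $\delta > 0$ and suppose that $|A| \geq \delta |G||H|$. Then there exist subspaces $U \leq G$ and $V \leq H$, a non-negative integer $r$ and a bilinear map $\beta \colon G \times H \to \mathbb{F}_p^r$ such that \[\{(x,y) \in U \times V \colon \beta(x,y) = 0\} \subseteq A\] and \[\dim (G/U) \leq C (\log_p \delta^{-1})^3, \qquad \dim (H/V) \leq C (\log_p \delta^{-1})^2, \qquad r \leq C \log_p \delta^{-1}.\] -/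

import Mathlib

/-- `A ⊆ G × H` is transverse if each column `{y | (x, y) ∈ A}` is a (non-empty) linear subspace
of `H` and each row `{x | (x, y) ∈ A}` is a (non-empty) linear subspace of `G`. -/
def IsTransverse (K : Type*) {G H : Type*} [Field K] [AddCommGroup G] [Module K G]
    [AddCommGroup H] [Module K H] (A : Set (G × H)) : Prop :=
  (∀ x : G, ∃ W : Submodule K H, (W : Set H) = {y | (x, y) ∈ A}) ∧
    ∀ y : H, ∃ W : Submodule K G, (W : Set G) = {x | (x, y) ∈ A}

/-- The bilinear variety `{(x, y) ∈ U × V : β (x, y) = 0}` of a bilinear map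
`β : G × H → K ^ r`. -/
def bilinearVariety {K G H : Type*} [Field K] [AddCommGroup G] [Module K G]
    [AddCommGroup H] [Module K H] (U : Submodule K G) (V : Submodule K H) {r : ℕ}
    (β : G →ₗ[K] H →ₗ[K] (Fin r → K)) : Set (G × H) :=
  {q | q.1 ∈ U ∧ q.2 ∈ V ∧ β q.1 q.2 = 0}

/-! Dually, the annihilators `B x` of the columns satisfy `B (x + y) ≤ B x ⊔ B y`. It suffices to
trap every `B x`, for `x` in a large `U`, in a fixed small `F` plus the span of a few vectors
depending linearly on `x`: then `V` is the coannihilator of `F`, and those vectors are the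
coordinates of `β`.

For density at least `p ^ (-k)`, some intersection of three rows is a `U` on which three quarters of
the `B x` have dimension at most `k` (`exists_submodule_few_large_codim`). Factoring out an `F` of
dimension `O(k ^ 2)` makes a typical `B x` disjoint from any given small subspace
(`exists_generic_quotient`). If `B a` is then a largest member, `B (a + x)` is, for typical `x`, the
graph of a map `Φ x : B a → B x`. By genericity `Φ (z + y) - Φ y` does not depend on `y`, so it is
linear in `z`, and its range contains `B z` (`exists_linear_of_generic`). A basis of `B a` yields at
most `k` linear maps.

Rounding the logarithm up to `k` is harmless because densities just below 1 do not occur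
(`sum_card_col_le_of_ne_top`). -/

/-- A family of subspaces `B x ≤ M` indexed by a group is subadditive if
`B (x + y) ≤ B x ⊔ B y` and `B (-x) ≤ B x`. -/
structure IsSubadditiveFamily {K G M : Type*} [Field K] [AddCommGroup G] [AddCommGroup M]
    [Module K M] (B : G → Submodule K M) : Prop where
  add_le : ∀ x y, B (x + y) ≤ B x ⊔ B y
  neg_le : ∀ x, B (-x) ≤ B x

namespace IsSubadditiveFamily

/-! ### Graphs over a largest member. -/

section Graph

variable {K G M : Type*} [Field K] [AddCommGroup G] [AddCommGroup M] [Module K M]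
  {B : G → Submodule K M}

theorem sub_le (hB : IsSubadditiveFamily B) (x y : G) : B (x - y) ≤ B x ⊔ B y := by
  rw [sub_eq_add_neg]
  exact (hB.add_le x (-y)).trans (sup_le_sup_left (hB.neg_le y) _)

theorem le_add_left (hB : IsSubadditiveFamily B) (x y : G) : B x ≤ B (x + y) ⊔ B y := by
  simpa using hB.sub_le (x + y) y

/-- If `B a` meets `B x` trivially, then `dim B a ≤ dim B (a + x)`. -/
theorem finrank_le_of_disjoint [FiniteDimensional K M] (hB : IsSubadditiveFamily B) {a x : G}
    (h : Disjoint (B x) (B a)) : Module.finrank K (B a) ≤ Module.finrank K (B (a + x)) := by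
  have h1 := Submodule.finrank_sup_add_finrank_inf_eq (B a) (B x)
  have h2 := Submodule.finrank_sup_add_finrank_inf_eq (B (a + x)) (B x)
  have h3 : Module.finrank K ↥(B a ⊔ B x) ≤ Module.finrank K ↥(B (a + x) ⊔ B x) :=
    Submodule.finrank_mono (sup_le (hB.le_add_left a x) le_sup_right)
  rw [h.symm.eq_bot, finrank_bot] at h1
  omega

/-- If `B a` has maximal dimension and meets `B x` trivially, then `B (a + x)` and `B x` are
disjoint. -/
theorem disjoint_add [FiniteDimensional K M] (hB : IsSubadditiveFamily B) {a x : G}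
    (ha : ∀ y, Module.finrank K (B y) ≤ Module.finrank K (B a)) (h : Disjoint (B x) (B a)) :
    Disjoint (B (a + x)) (B x) := by
  have h1 := Submodule.finrank_sup_add_finrank_inf_eq (B a) (B x)
  have h2 := Submodule.finrank_sup_add_finrank_inf_eq (B (a + x)) (B x)
  -- With `h1` and `h2` this squeezes: maximality of `B a` leaves no room for an intersection.
  have h3 : Module.finrank K ↥(B a ⊔ B x) ≤ Module.finrank K ↥(B (a + x) ⊔ B x) :=
    Submodule.finrank_mono (sup_le (hB.le_add_left a x) le_sup_right)
  rw [h.symm.eq_bot, finrank_bot] at h1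
  have h4 := ha (a + x)
  rw [disjoint_iff, ← Submodule.finrank_eq_zero (R := K)]
  omega

/-- `B (a + x)` is the graph of a linear map from `B a` to `B x`. -/
theorem exists_graph [FiniteDimensional K M] (hB : IsSubadditiveFamily B) {a x : G}
    (ha : ∀ y, Module.finrank K (B y) ≤ Module.finrank K (B a)) (h : Disjoint (B x) (B a)) :
    ∃ f : B a →ₗ[K] M, (∀ w, f w ∈ B x ∧ (w : M) + f w ∈ B (a + x)) ∧
      ∀ (w : B a) (b : M), b ∈ B x → (w : M) + b ∈ B (a + x) → b = f w := by
  have hdis := hB.disjoint_add ha h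
  have hex : ∀ w : B a, ∃ b ∈ B x, (w : M) + b ∈ B (a + x) := by
    intro w
    obtain ⟨c, hc, d, hd, hcd⟩ := Submodule.mem_sup.1 (hB.le_add_left a x w.2)
    refine ⟨-d, neg_mem hd, ?_⟩
    rw [← hcd]
    simpa using hc
  have huniq : ∀ (w : M) (b b' : M), b ∈ B x → b' ∈ B x → w + b ∈ B (a + x) →
      w + b' ∈ B (a + x) → b = b' := by
    intro w b b' hb hb' h1 h2
    have h3 : b - b' ∈ B (a + x) := by
      have := sub_mem h1 h2
      simpa using this
    exact sub_eq_zero.1 (Submodule.disjoint_def.1 hdis _ h3 (sub_mem hb hb'))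
  choose f hf1 hf2 using hex
  refine ⟨{ toFun := f, map_add' := ?_, map_smul' := ?_ }, fun w => ⟨hf1 w, hf2 w⟩,
    fun w b hb hwb => huniq w _ _ hb (hf1 w) hwb (hf2 w)⟩
  · intro v w
    refine huniq (v + w : B a) _ _ (hf1 _) (add_mem (hf1 _) (hf1 _)) (hf2 _) ?_
    have := add_mem (hf2 v) (hf2 w)
    rw [Submodule.coe_add]
    convert this using 1
    abel
  · intro c w
    refine huniq (c • w : B a) _ _ (hf1 _) (Submodule.smul_mem _ _ (hf1 _)) (hf2 _) ?_
    have := Submodule.smul_mem _ c (hf2 w)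
    simpa [smul_add] using this

end Graph

/-! ### Linearity of generic families. -/

section Generic

variable {K G M : Type*} [Field K] [AddCommGroup G] [AddCommGroup M] [Module K M]
  {B : G → Submodule K M}

/-- Four translates of generic conditions, each failing on at most a fifth of the group, can be
satisfied simultaneously. -/
theorem exists_forall_disjoint [Finite G] {d : ℕ}
    (hgen : ∀ Q : Submodule K M, Module.finrank K Q ≤ d →
      5 * Nat.card {x // ¬ Disjoint (B x) Q} ≤ Nat.card G)
    (z : Fin 4 → G) (Q : Fin 4 → Submodule K M) (hQ : ∀ i, Module.finrank K (Q i) ≤ d) :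
    ∃ y, ∀ i, Disjoint (B (z i + y)) (Q i) := by
  classical
  have := Fintype.ofFinite G
  by_contra! hcon
  have hcard : ∀ i, 5 * (Finset.univ.filter fun y => ¬ Disjoint (B (z i + y)) (Q i)).card
      ≤ Fintype.card G := by
    intro i
    have h1 := hgen (Q i) (hQ i)
    rw [Nat.card_eq_fintype_card, Nat.card_eq_fintype_card] at h1
    rw [← Fintype.card_subtype]
    refine le_trans (Nat.mul_le_mul_left _ (le_of_eq ?_)) h1
    exact Fintype.card_congr
      ((Equiv.addLeft (z i)).subtypeEquiv (fun y => by simp))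
  have hcover : (Finset.univ : Finset G) ⊆
      Finset.univ.biUnion fun i => Finset.univ.filter fun y => ¬ Disjoint (B (z i + y)) (Q i) := by
    intro y _
    obtain ⟨i, hi⟩ := hcon y
    simp only [Finset.mem_biUnion, Finset.mem_univ, Finset.mem_filter, true_and]
    exact ⟨i, hi⟩
  have h1 := (Finset.card_le_card hcover).trans Finset.card_biUnion_le
  have h2 := hcard 0
  have h3 := hcard 1
  have h4 := hcard 2
  have h5 := hcard 3
  rw [Fin.sum_univ_four, Finset.card_univ] at h1
  have : 0 < Fintype.card G := Fintype.card_pos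
  omega

end Generic

section Structure

variable {p : ℕ} [Fact p.Prime] {G M : Type*} [AddCommGroup G] [Module (ZMod p) G] [Finite G]
  [AddCommGroup M] [Module (ZMod p) M] [FiniteDimensional (ZMod p) M]
  {B : G → Submodule (ZMod p) M}

/-- A subadditive family whose members are generically independent is contained in the image of
a linear family of maps defined on the largest member. -/
theorem exists_linear_of_generic (hB : IsSubadditiveFamily B) {a : G}
    (ha : ∀ y, Module.finrank (ZMod p) (B y) ≤ Module.finrank (ZMod p) (B a))
    (hgen : ∀ Q : Submodule (ZMod p) M,
      Module.finrank (ZMod p) Q ≤ 3 * Module.finrank (ZMod p) (B a) →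
        5 * Nat.card {x // ¬ Disjoint (B x) Q} ≤ Nat.card G) :
    ∃ Ψ : G →ₗ[ZMod p] B a →ₗ[ZMod p] M, ∀ x, B x ≤ LinearMap.range (Ψ x) := by
  set s := Module.finrank (ZMod p) (B a)
  -- `Φ` takes the junk value 0 where `B x` meets `B a`.
  have hex : ∀ x, ∃ f : B a →ₗ[ZMod p] M, Disjoint (B x) (B a) →
      (∀ w, f w ∈ B x ∧ (w : M) + f w ∈ B (a + x)) ∧
      ∀ (w : B a) (b : M), b ∈ B x → (w : M) + b ∈ B (a + x) → b = f w := by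
    intro x
    by_cases h : Disjoint (B x) (B a)
    · obtain ⟨f, hf⟩ := hB.exists_graph ha h
      exact ⟨f, fun _ => hf⟩
    · exact ⟨0, fun h' => absurd h' h⟩
  choose Φ hΦ using hex
  have hsurj : ∀ x, Disjoint (B x) (B a) → B x ≤ LinearMap.range (Φ x) := by
    intro x hx b hb
    have h1 : B x ≤ B (a + x) ⊔ B a := by
      rw [add_comm]; exact hB.le_add_left x a
    obtain ⟨c, hc, d, hd, hcd⟩ := Submodule.mem_sup.1 (h1 hb)
    refine ⟨⟨-d, neg_mem hd⟩, ((hΦ x hx).2 _ b hb ?_).symm⟩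
    rw [← hcd]
    simpa using hc
  have hadd : ∀ x y, Disjoint (B x) (B a) → Disjoint (B y) (B a ⊔ B x) →
      Disjoint (B (x + y)) (B a) ∧ Φ (x + y) = Φ x + Φ y := by
    intro x y hx hy
    have hya : Disjoint (B y) (B a) := hy.mono_right le_sup_left
    have hxy : Disjoint (B x) (B a ⊔ B y) := by
      refine hx.disjoint_sup_right_of_disjoint_sup_left ?_
      rw [sup_comm]
      exact hy.symm
    have hxya : Disjoint (B (x + y)) (B a) := by
      rw [sup_comm] at hy
      refine Disjoint.mono_left (hB.add_le x y) ?_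
      rw [sup_comm]
      exact hx.disjoint_sup_left_of_disjoint_sup_right hy
    refine ⟨hxya, ?_⟩
    ext w
    obtain ⟨h1, h2⟩ := (hΦ _ hxya).1 w
    obtain ⟨c, hc, d, hd, hcd⟩ := Submodule.mem_sup.1 (hB.add_le x y h1)
    -- Splitting `w + (c + d)` along `B (a + x) ⊔ B y` and using independence puts `w + c` in `B (a
    -- + x)`, so `c` is the graph value at `w`.
    have key : ∀ x y : G, ∀ c d : M, Disjoint (B x) (B a) → Disjoint (B y) (B a ⊔ B x) →
        c ∈ B x → d ∈ B y → (w : M) + (c + d) ∈ B (a + (x + y)) → c = Φ x w := by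
      intro x y c d hx hy hc hd h
      rw [← add_assoc a] at h
      obtain ⟨e, he, f, hf, hef⟩ := Submodule.mem_sup.1 (hB.add_le (a + x) y h)
      have h3 : f - d = w + c - e := by
        rw [sub_eq_sub_iff_add_eq_add, add_comm f e, hef]; abel
      have h4 : w + c - e ∈ B a ⊔ B x :=
        sub_mem (add_mem (Submodule.mem_sup_left w.2) (Submodule.mem_sup_right hc))
          (hB.add_le a x he)
      have h5 := Submodule.disjoint_def.1 hy (f - d) (sub_mem hf hd) (h3 ▸ h4)
      have h6 : (w : M) + c = e := by rw [h3] at h5; exact sub_eq_zero.1 h5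
      exact (hΦ x hx).2 w c hc (h6 ▸ he)
    rw [LinearMap.add_apply, ← hcd, ← key x y c d hx hy hc hd (by rw [hcd]; exact h2),
      ← key y x d c hya hxy hd hc (by rw [add_comm d, hcd, add_comm y]; exact h2)]
  have hsup : ∀ Q R : Submodule (ZMod p) M, Module.finrank (ZMod p) ↥(Q ⊔ R) ≤
      Module.finrank (ZMod p) Q + Module.finrank (ZMod p) R :=
    fun Q R => Submodule.finrank_add_le_finrank_add_finrank Q R
  have hgood : ∀ z z' : G, ∃ y, Disjoint (B y) (B a) ∧ Disjoint (B (z + y)) (B a) ∧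
      Disjoint (B (z' + y)) (B a) := by
    intro z z'
    obtain ⟨y, hy⟩ := exists_forall_disjoint hgen ![0, z, z', 0] (fun _ => B a)
      (fun _ => by omega)
    have h0 := hy 0
    have h1 := hy 1
    have h2 := hy 2
    simp only [Matrix.cons_val, zero_add] at h0 h1 h2
    exact ⟨y, h0, h1, h2⟩
  have hwd : ∀ z y y', Disjoint (B y) (B a) → Disjoint (B (z + y)) (B a) →
      Disjoint (B y') (B a) → Disjoint (B (z + y')) (B a) →
      Φ (z + y) - Φ y = Φ (z + y') - Φ y' := by
    intro z y y' hy hzy hy' hzy'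
    -- For such `u`, expanding `Φ (z + y + u)` in two ways gives `Φ (z + y) - Φ y = Φ (z + u) - Φ
    -- u`, and likewise for `y'`.
    obtain ⟨u, hu⟩ := exists_forall_disjoint hgen ![0, z, 0, z]
      ![B a ⊔ B (z + y), B a ⊔ B y, B a ⊔ B (z + y'), B a ⊔ B y'] (by
        have hle : ∀ x, Module.finrank (ZMod p) ↥(B a ⊔ B x) ≤ 3 * s := fun x => by
          have := hsup (B a) (B x)
          have := ha x
          omega
        intro i
        fin_cases i <;> exact hle _)
    have h0 := hu 0
    have h1 := hu 1
    have h2 := hu 2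
    have h3 := hu 3
    simp only [Matrix.cons_val, zero_add] at h0 h1 h2 h3
    have e0 := (hadd _ _ hzy h0).2
    have e1 := (hadd _ _ hy h1).2
    have e2 := (hadd _ _ hzy' h2).2
    have e3 := (hadd _ _ hy' h3).2
    have e4 : z + y + u = y + (z + u) := by abel
    have e5 : z + y' + u = y' + (z + u) := by abel
    rw [e4, e1] at e0
    rw [e5, e3] at e2
    have f0 : Φ (z + y) - Φ y = Φ (z + u) - Φ u := by
      rw [sub_eq_sub_iff_add_eq_add, ← e0, add_comm]
    have f2 : Φ (z + y') - Φ y' = Φ (z + u) - Φ u := by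
      rw [sub_eq_sub_iff_add_eq_add, ← e2, add_comm]
    rw [f0, f2]
  choose y₀ hy₀ using fun z => hgood z 0
  let Ψ : G →+ (B a →ₗ[ZMod p] M) := AddMonoidHom.mk' (fun z => Φ (z + y₀ z) - Φ (y₀ z)) (by
    intro z z'
    obtain ⟨y, h0, h1, h2⟩ := hgood z' (z + z')
    have e1 := hwd (z + z') _ y (hy₀ _).1 (hy₀ _).2.1 h0 h2
    have e2 := hwd z' _ y (hy₀ _).1 (hy₀ _).2.1 h0 h1
    have e3 := hwd z _ (z' + y) (hy₀ _).1 (hy₀ _).2.1 h1 (by rw [← add_assoc]; exact h2)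
    rw [e1, e2, e3, add_assoc]
    abel)
  have hΨ : ∀ z y, Disjoint (B y) (B a) → Disjoint (B (z + y)) (B a) →
      Ψ z = Φ (z + y) - Φ y := fun z y h1 h2 => hwd z _ y (hy₀ _).1 (hy₀ _).2.1 h1 h2
  refine ⟨Ψ.toZModLinearMap p, fun z b hb => ?_⟩
  -- Up to an error in `B y`, the vector `b` lies in the range of `Ψ z`. Comparing two independent
  -- choices of `y` kills the error.
  have hrange : ∀ y, Disjoint (B y) (B a) → Disjoint (B (z + y)) (B a) →
      ∃ u ∈ LinearMap.range (Ψ z), ∃ v ∈ B y, b = u + v := by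
    intro y h1 h2
    obtain ⟨c, hc, d, hd, hcd⟩ := Submodule.mem_sup.1 (hB.le_add_left z y hb)
    obtain ⟨w, rfl⟩ := hsurj _ h2 hc
    refine ⟨Ψ z w, ⟨w, rfl⟩, Φ y w + d, add_mem ((hΦ y h1).1 w).1 hd, ?_⟩
    rw [hΨ z y h1 h2, ← hcd, LinearMap.sub_apply]
    abel
  obtain ⟨y, h1, h2, -⟩ := hgood z 0
  obtain ⟨u, hu, v, hv, huv⟩ := hrange y h1 h2
  obtain ⟨y', hy'⟩ := exists_forall_disjoint hgen ![0, 0, z, 0]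
    ![LinearMap.range (Ψ z) ⊔ B y, B a, B a, B a] (by
      have hle : Module.finrank (ZMod p) ↥(LinearMap.range (Ψ z) ⊔ B y) ≤ 3 * s := by
        have h3 := hsup (LinearMap.range (Ψ z)) (B y)
        have h4 := ha y
        have h5 := LinearMap.finrank_range_le (Ψ z)
        omega
      have hle' : Module.finrank (ZMod p) (B a) ≤ 3 * s := by omega
      intro i
      fin_cases i
      exacts [hle, hle', hle', hle'])
  have h3 := hy' 0
  have h4 := hy' 1
  have h5 := hy' 2
  simp only [Matrix.cons_val, zero_add] at h3 h4 h5
  obtain ⟨u', hu', v', hv', huv'⟩ := hrange y' h4 h5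
  have h6 : v' = u - u' + v := by
    rw [huv] at huv'
    rw [sub_add_eq_add_sub, huv', add_sub_cancel_left]
  have h7 : v' = 0 := Submodule.disjoint_def.1 h3 v' hv' (by
    rw [h6]
    exact add_mem (Submodule.mem_sup_left (sub_mem hu hu')) (Submodule.mem_sup_right hv))
  rw [huv', h7, add_zero]
  exact hu'

end Structure

end IsSubadditiveFamily

namespace IsSubadditiveFamily

/-! ### Making a family generic by a quotient. -/

section Quotient

variable {K G M : Type*} [Field K] [AddCommGroup G] [AddCommGroup M] [Module K M]
  {B : G → Submodule K M}

theorem map {N : Type*} [AddCommGroup N] [Module K N] (hB : IsSubadditiveFamily B)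
    (f : M →ₗ[K] N) : IsSubadditiveFamily fun x => (B x).map f where
  add_le x y := by
    rw [← Submodule.map_sup]
    exact Submodule.map_mono (hB.add_le x y)
  neg_le x := Submodule.map_mono (hB.neg_le x)

/-- If more than half of the members have dimension at most `k`, then all members have dimension
at most `2 * k`. -/
theorem finrank_le_two_mul [Finite G] [FiniteDimensional K M] (hB : IsSubadditiveFamily B) {k : ℕ}
    (hk : 4 * Nat.card {x // k < Module.finrank K (B x)} ≤ Nat.card G) (x : G) :
    Module.finrank K (B x) ≤ 2 * k := by
  classical
  have := Fintype.ofFinite G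
  rw [Nat.card_eq_fintype_card, Nat.card_eq_fintype_card, Fintype.card_subtype] at hk
  have htrans : (Finset.univ.filter fun y => k < Module.finrank K (B (x + y))).card =
      (Finset.univ.filter fun y => k < Module.finrank K (B y)).card := by
    rw [← Fintype.card_subtype, ← Fintype.card_subtype]
    exact Fintype.card_congr ((Equiv.addLeft x).subtypeEquiv (fun _ => Iff.rfl))
  have hex : ∃ y, Module.finrank K (B (x + y)) ≤ k ∧ Module.finrank K (B y) ≤ k := by
    by_contra! hcon
    have hcover : (Finset.univ : Finset G) ⊆
        (Finset.univ.filter fun y => k < Module.finrank K (B (x + y))) ∪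
        (Finset.univ.filter fun y => k < Module.finrank K (B y)) := by
      intro y _
      simp only [Finset.mem_union, Finset.mem_filter, Finset.mem_univ, true_and]
      by_contra! h
      exact absurd (hcon y h.1) (not_lt.2 h.2)
    have h1 := (Finset.card_le_card hcover).trans (Finset.card_union_le _ _)
    rw [Finset.card_univ] at h1
    have : 0 < Fintype.card G := Fintype.card_pos
    omega
  obtain ⟨y, h1, h2⟩ := hex
  have h3 := Submodule.finrank_mono (hB.le_add_left x y)
  have h4 := Submodule.finrank_add_le_finrank_add_finrank (B (x + y)) (B y)
  omega

/-- There is a subspace `F` of bounded dimension modulo which a family of subspaces of bounded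
dimension is generically disjoint from any given small subspace. -/
theorem exists_generic_quotient [Finite G] [FiniteDimensional K M] (B : G → Submodule K M)
    {d L : ℕ} (hd : ∀ x, Module.finrank K (B x) ≤ d) :
    ∃ F : Submodule K M, Module.finrank K F ≤ L * d ∧
      ∀ Q : Submodule K (M ⧸ F),
        L * Nat.card {x // ¬ Disjoint ((B x).map F.mkQ) Q} ≤ Nat.card G * Module.finrank K Q := by
  classical
  have := Fintype.ofFinite G
  simp only [Nat.card_eq_fintype_card, Fintype.card_subtype]
  -- `F` maximises this potential: comparison with `⊥` bounds its dimension, comparison with the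
  -- preimage of `Q` gives genericity.
  let g : Submodule K M → ℤ := fun F =>
    L * ∑ x, (Module.finrank K ↥(B x ⊓ F) : ℤ) - Fintype.card G * Module.finrank K F
  have hGpos : 0 < Fintype.card G := Fintype.card_pos
  have hsum : ∀ F : Submodule K M,
      ∑ x, (Module.finrank K ↥(B x ⊓ F) : ℤ) ≤ Fintype.card G * d := by
    intro F
    have h1 : ∀ x ∈ (Finset.univ : Finset G), (Module.finrank K ↥(B x ⊓ F) : ℤ) ≤ d := by
      intro x _
      exact_mod_cast (Submodule.finrank_mono inf_le_left).trans (hd x)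
    simpa using Finset.sum_le_card_nsmul _ _ _ h1
  obtain ⟨F, hF⟩ : ∃ F, ∀ F', g F' ≤ g F := by
    have hbdd : ∃ b : ℤ, ∀ z : ℤ, (∃ F, g F = z) → z ≤ b := by
      refine ⟨L * (Fintype.card G * d), ?_⟩
      rintro _ ⟨F, rfl⟩
      have h2 : (0 : ℤ) ≤ Fintype.card G * Module.finrank K F := by positivity
      have h3 := mul_le_mul_of_nonneg_left (hsum F) (Int.natCast_nonneg L)
      simp only [g]
      linarith
    obtain ⟨z, ⟨F, hF⟩, hz⟩ := Int.exists_greatest_of_bdd hbdd ⟨g ⊥, ⊥, rfl⟩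
    exact ⟨F, fun F' => hF ▸ hz _ ⟨F', rfl⟩⟩
  refine ⟨F, ?_, fun Q => ?_⟩
  · have h1 := hF ⊥
    have h2 : ∑ x, (Module.finrank K ↥(B x ⊓ ⊥) : ℤ) = 0 :=
      Finset.sum_eq_zero fun x _ => by rw [inf_bot_eq, finrank_bot, Nat.cast_zero]
    simp only [g, h2, finrank_bot] at h1
    have h3 := mul_le_mul_of_nonneg_left (hsum F) (Int.natCast_nonneg L)
    have h4 : (Fintype.card G : ℤ) * Module.finrank K F ≤ Fintype.card G * (L * d) := by
      push_cast at h1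
      linarith
    exact_mod_cast le_of_mul_le_mul_left h4 (by exact_mod_cast hGpos)
  · have hle : F ≤ Q.comap F.mkQ := fun x hx => by
      simp [(Submodule.Quotient.mk_eq_zero F).2 hx]
    have hdim : Module.finrank K (Q.comap F.mkQ) =
        Module.finrank K F + Module.finrank K Q := by
      have h1 := (F.mkQ.domRestrict (Q.comap F.mkQ)).finrank_range_add_finrank_ker
      rw [LinearMap.range_domRestrict, Submodule.map_comap_eq, F.range_mkQ, top_inf_eq,
        LinearMap.ker_domRestrict, F.ker_mkQ,
        (Submodule.comapSubtypeEquivOfLe hle).finrank_eq] at h1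
      omega
    have h1 := hF (Q.comap F.mkQ)
    have hstep : ∀ x, (Module.finrank K ↥(B x ⊓ F) : ℤ) +
        (if ¬ Disjoint ((B x).map F.mkQ) Q then 1 else 0) ≤
        Module.finrank K ↥(B x ⊓ Q.comap F.mkQ) := by
      intro x
      have hmono : B x ⊓ F ≤ B x ⊓ Q.comap F.mkQ := inf_le_inf_left _ hle
      by_cases h : Disjoint ((B x).map F.mkQ) Q
      · simpa [h] using Submodule.finrank_mono hmono
      · have hlt : B x ⊓ F < B x ⊓ Q.comap F.mkQ := by
          refine lt_of_le_of_ne hmono fun heq => h ?_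
          rw [Submodule.disjoint_def]
          rintro _ ⟨b, hb, rfl⟩ hbQ
          have : b ∈ B x ⊓ F := heq ▸ ⟨hb, hbQ⟩
          exact (Submodule.Quotient.mk_eq_zero F).2 this.2
        rw [if_pos h]
        exact_mod_cast Submodule.finrank_lt_finrank_of_lt hlt
    have h2 := Finset.sum_le_sum fun x (_ : x ∈ (Finset.univ : Finset G)) => hstep x
    rw [Finset.sum_add_distrib, Finset.sum_boole] at h2
    have h3 := mul_le_mul_of_nonneg_left h2 (Int.natCast_nonneg L)
    simp only [g, hdim] at h1
    push_cast at h1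
    zify
    linarith

end Quotient

/-! ### Covering a family by linear maps. -/

section Cover

variable {p : ℕ} [Fact p.Prime] {G M : Type*} [AddCommGroup G] [Module (ZMod p) G] [Finite G]
  [AddCommGroup M] [Module (ZMod p) M] [FiniteDimensional (ZMod p) M]
  {B : G → Submodule (ZMod p) M}

/-- A subadditive family most of whose members have dimension at most `k` is contained, modulo a
subspace of dimension `O(k ^ 2)`, in the span of at most `k` linear maps. -/
theorem exists_linear_cover (hB : IsSubadditiveFamily B) {k : ℕ} (hk : 1 ≤ k)
    (hbad : 4 * Nat.card {x // k < Module.finrank (ZMod p) (B x)} ≤ Nat.card G) :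
    ∃ F : Submodule (ZMod p) M, Module.finrank (ZMod p) F ≤ 60 * k ^ 2 ∧
      ∃ r ≤ k, ∃ φ : Fin r → G →ₗ[ZMod p] M,
        ∀ x, B x ≤ F ⊔ Submodule.span (ZMod p) (Set.range fun i => φ i x) := by
  -- Members have dimension at most `2 * k`, so `6 * k` is three times the largest; `L = 30 * k`
  -- makes the failure rate `6 * k / L` equal to one fifth.
  obtain ⟨F, hF, hgen⟩ := exists_generic_quotient B (L := 30 * k) (hB.finrank_le_two_mul hbad)
  refine ⟨F, hF.trans (by nlinarith), ?_⟩
  set B' : G → Submodule (ZMod p) (M ⧸ F) := fun x => (B x).map F.mkQ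
  have hB' : IsSubadditiveFamily B' := hB.map F.mkQ
  have hle : ∀ x, Module.finrank (ZMod p) (B' x) ≤ Module.finrank (ZMod p) (B x) :=
    fun x => Submodule.finrank_map_le _ _
  have hgen' : ∀ Q : Submodule (ZMod p) (M ⧸ F), Module.finrank (ZMod p) Q ≤ 6 * k →
      5 * Nat.card {x // ¬ Disjoint (B' x) Q} ≤ Nat.card G := by
    intro Q hQ
    have h1 := (hgen Q).trans (Nat.mul_le_mul_left _ hQ)
    have h2 : (6 * k) * (5 * Nat.card {x // ¬ Disjoint (B' x) Q}) ≤ (6 * k) * Nat.card G := by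
      calc _ = 30 * k * Nat.card {x // ¬ Disjoint (B' x) Q} := by ring
        _ ≤ _ := h1
        _ = _ := by ring
    exact Nat.le_of_mul_le_mul_left h2 (by omega)
  obtain ⟨a, ha⟩ := Finite.exists_max fun x => Module.finrank (ZMod p) (B' x)
  -- As `1 / 4 + 1 / 5 < 1`, some `y` has both `B' y` disjoint from `B' a` and `dim B (a + y) ≤ k`;
  -- this improves `2 * k` to `k`.
  have hak : Module.finrank (ZMod p) (B' a) ≤ k := by
    classical
    have := Fintype.ofFinite G
    have h1 := hgen' (B' a) (by
      have := hle a
      have := hB.finrank_le_two_mul hbad a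
      omega)
    rw [Nat.card_eq_fintype_card, Nat.card_eq_fintype_card, Fintype.card_subtype] at h1 hbad
    have htrans : (Finset.univ.filter fun y => k < Module.finrank (ZMod p) (B (a + y))).card =
        (Finset.univ.filter fun y => k < Module.finrank (ZMod p) (B y)).card := by
      rw [← Fintype.card_subtype, ← Fintype.card_subtype]
      exact Fintype.card_congr ((Equiv.addLeft a).subtypeEquiv (fun _ => Iff.rfl))
    by_contra! hcon
    have hcover : (Finset.univ : Finset G) ⊆
        (Finset.univ.filter fun y => k < Module.finrank (ZMod p) (B (a + y))) ∪
        (Finset.univ.filter fun y => ¬ Disjoint (B' y) (B' a)) := by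
      intro y _
      simp only [Finset.mem_union, Finset.mem_filter, Finset.mem_univ, true_and]
      by_contra! h
      have h2 := hB'.finrank_le_of_disjoint h.2
      have h3 := hle (a + y)
      omega
    have h2 := (Finset.card_le_card hcover).trans (Finset.card_union_le _ _)
    rw [Finset.card_univ] at h2
    have : 0 < Fintype.card G := Fintype.card_pos
    omega
  obtain ⟨Ψ, hΨ⟩ := hB'.exists_linear_of_generic ha fun Q hQ => hgen' Q (by omega)
  obtain ⟨σ, hσ⟩ := F.mkQ.exists_rightInverse_of_surjective F.range_mkQ
  let e := Module.finBasis (ZMod p) (B' a)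
  refine ⟨_, hak, fun i => σ ∘ₗ Ψ.flip (e i), fun x b hb => ?_⟩
  obtain ⟨w, hw⟩ := hΨ x (Submodule.mem_map_of_mem hb)
  have h1 : σ (Ψ x w) ∈ Submodule.span (ZMod p)
      (Set.range fun i => (σ ∘ₗ Ψ.flip (e i)) x) := by
    rw [← e.sum_repr w, map_sum, map_sum]
    refine Submodule.sum_mem _ fun i _ => ?_
    rw [map_smul, map_smul]
    exact Submodule.smul_mem _ _ (Submodule.subset_span ⟨i, rfl⟩)
  have h2 : b - σ (Ψ x w) ∈ F := by
    rw [← Submodule.Quotient.mk_eq_zero F, ← Submodule.mkQ_apply, map_sub, hw]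
    have := LinearMap.congr_fun hσ (F.mkQ b)
    simp only [LinearMap.comp_apply, LinearMap.id_apply] at this
    rw [this, sub_self]
  have h3 := Submodule.add_mem_sup h2 h1
  simpa using h3

end Cover

end IsSubadditiveFamily

/-! ### Counting in transverse sets. -/

section Restriction

variable {p : ℕ} [Fact p.Prime] {G H : Type*} [AddCommGroup G] [Module (ZMod p) G]
  [AddCommGroup H] [Module (ZMod p) H] {col : G → Submodule (ZMod p) H}
  {row : H → Submodule (ZMod p) G}

theorem natCard_eq_pow_finrank_zmod (V : Type*) [AddCommGroup V] [Module (ZMod p) V]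
    [FiniteDimensional (ZMod p) V] : Nat.card V = p ^ Module.finrank (ZMod p) V := by
  rw [Module.natCard_eq_pow_finrank (K := ZMod p), Nat.card_zmod]

theorem natCard_submodule_mul_pow_finrank_quotient {V : Type*} [AddCommGroup V]
    [Module (ZMod p) V] [FiniteDimensional (ZMod p) V] (W : Submodule (ZMod p) V) :
    Nat.card W * p ^ Module.finrank (ZMod p) (V ⧸ W) = Nat.card V := by
  rw [natCard_eq_pow_finrank_zmod (p := p) W, natCard_eq_pow_finrank_zmod (p := p) V, ← pow_add,
    add_comm, W.finrank_quotient_add_finrank]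

theorem mul_natCard_le_of_ne_top {V : Type*} [AddCommGroup V] [Module (ZMod p) V]
    [FiniteDimensional (ZMod p) V] {W : Submodule (ZMod p) V} (hW : W ≠ ⊤) :
    p * Nat.card W ≤ Nat.card V := by
  rw [← natCard_submodule_mul_pow_finrank_quotient W, mul_comm]
  refine Nat.mul_le_mul_left _ (Nat.le_self_pow ?_ p)
  have h1 := Submodule.finrank_lt hW
  have h2 := W.finrank_quotient_add_finrank
  omega

/-- Double counting of incidences between points of `S` and triples of rows. -/
theorem sum_card_filter_rows [Fintype G] [Fintype H] (hcr : ∀ x y, y ∈ col x ↔ x ∈ row y)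
    (S : Finset G) [∀ y : Fin 3 → H, DecidablePred fun x => ∀ i, x ∈ row (y i)] :
    ∑ y : Fin 3 → H, (S.filter fun x => ∀ i, x ∈ row (y i)).card =
      ∑ x ∈ S, Nat.card (col x) ^ 3 := by
  classical
  simp_rw [Finset.card_filter]
  rw [Finset.sum_comm]
  refine Finset.sum_congr rfl fun x _ => ?_
  rw [← Finset.card_filter]
  have h1 : (Finset.univ.filter fun y : Fin 3 → H => ∀ i, x ∈ row (y i)) =
      Fintype.piFinset fun _ : Fin 3 => Finset.univ.filter fun h => h ∈ col x := by
    ext y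
    simp [hcr]
  rw [h1, Fintype.card_piFinset_const, ← Fintype.card_subtype, Nat.card_eq_fintype_card]

/-- A dense transverse set has few columns of large codimension on a suitable intersection of
three rows. -/
theorem exists_submodule_few_large_codim [FiniteDimensional (ZMod p) G]
    [FiniteDimensional (ZMod p) H] (hcr : ∀ x y, y ∈ col x ↔ x ∈ row y) {k : ℕ}
    (hdense : Nat.card G * Nat.card H ≤ p ^ k * ∑ᶠ x, Nat.card (col x)) :
    ∃ U : Submodule (ZMod p) G, Nat.card G ≤ p ^ (3 * k + 1) * Nat.card U ∧
      4 * Nat.card {x : U // k < Module.finrank (ZMod p) (H ⧸ col x)} ≤ Nat.card U := by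
  classical
  have := Module.finite_of_finite (ZMod p) (M := G)
  have := Module.finite_of_finite (ZMod p) (M := H)
  have := Fintype.ofFinite G
  have := Fintype.ofFinite H
  have hp2 : 2 ≤ p := (Fact.out : p.Prime).two_le
  rw [finsum_eq_sum_of_fintype] at hdense
  set c : G → ℕ := fun x => Nat.card (col x) with hc
  set bad : Finset G := Finset.univ.filter fun x => k < Module.finrank (ZMod p) (H ⧸ col x)
    with hbad
  have hcardU : ∀ y : Fin 3 → H, Nat.card ↥(⨅ i, row (y i)) =
      (Finset.univ.filter fun x => ∀ i, x ∈ row (y i)).card := by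
    intro y
    rw [← Fintype.card_subtype, ← Nat.card_eq_fintype_card]
    exact Nat.card_congr (Equiv.subtypeEquivRight fun x => by simp [Submodule.mem_iInf])
  have hcardbad : ∀ y : Fin 3 → H,
      Nat.card {x : ↥(⨅ i, row (y i)) // k < Module.finrank (ZMod p) (H ⧸ col x)} =
        (bad.filter fun x => ∀ i, x ∈ row (y i)).card := by
    intro y
    rw [hbad, Finset.filter_filter, ← Fintype.card_subtype, ← Nat.card_eq_fintype_card]
    refine Nat.card_congr ((Equiv.subtypeSubtypeEquivSubtypeInter (· ∈ ⨅ i, row (y i))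
      (fun x => k < Module.finrank (ZMod p) (H ⧸ col x))).trans
      (Equiv.subtypeEquivRight fun x => ?_))
    simp [Submodule.mem_iInf, and_comm]
  by_contra! hcon
  -- Both ways for an intersection of rows to fail, in one inequality that can be summed over all
  -- triples.
  have hlt : ∀ y : Fin 3 → H,
      p ^ (3 * k + 1) * (Finset.univ.filter fun x => ∀ i, x ∈ row (y i)).card <
        Nat.card G + p ^ (3 * k + 1) * (4 * (bad.filter fun x => ∀ i, x ∈ row (y i)).card) := by
    intro y
    have h := hcon (⨅ i, row (y i))
    rw [hcardU, hcardbad] at h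
    by_cases h1 : Nat.card G ≤
        p ^ (3 * k + 1) * (Finset.univ.filter fun x => ∀ i, x ∈ row (y i)).card
    · have h2 := Nat.mul_lt_mul_of_pos_left (h h1) (show 0 < p ^ (3 * k + 1) by positivity)
      omega
    · omega
  have hsum := Finset.sum_lt_sum_of_nonempty Finset.univ_nonempty
    fun y (_ : y ∈ (Finset.univ : Finset (Fin 3 → H))) => hlt y
  rw [Finset.sum_add_distrib, ← Finset.mul_sum, ← Finset.mul_sum, ← Finset.mul_sum,
    sum_card_filter_rows hcr, sum_card_filter_rows hcr, Finset.sum_const, Finset.card_univ,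
    Fintype.card_fun, Fintype.card_fin, smul_eq_mul, ← Nat.card_eq_fintype_card] at hsum
  have hjensen : Nat.card G * Nat.card H ^ 3 ≤ p ^ (3 * k) * ∑ x, c x ^ 3 := by
    have h1 := pow_sum_le_card_mul_sum_pow (s := Finset.univ) (f := c) (fun _ _ => Nat.zero_le _) 2
    rw [Finset.card_univ, ← Nat.card_eq_fintype_card] at h1
    have h2 := Nat.pow_le_pow_left hdense 3
    have hG : 0 < Nat.card G ^ 2 := pow_pos Nat.card_pos 2
    refine Nat.le_of_mul_le_mul_left ?_ hG
    calc Nat.card G ^ 2 * (Nat.card G * Nat.card H ^ 3) = (Nat.card G * Nat.card H) ^ 3 := by ring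
      _ ≤ _ := h2
      _ = p ^ (3 * k) * (∑ x, c x) ^ 3 := by rw [mul_pow, ← pow_mul, mul_comm k 3]
      _ ≤ p ^ (3 * k) * (Nat.card G ^ 2 * ∑ x, c x ^ 3) := Nat.mul_le_mul_left _ h1
      _ = _ := by ring
  -- Three rows suffice: a bad column has density at most `p ^ (-(k + 1))`, and `4 * p ^ (3 * k + 1
  -- - 3 * (k + 1)) = 4 / p ^ 2 ≤ 1`.
  have hsmall : p ^ (3 * k + 1) * (4 * ∑ x ∈ bad, c x ^ 3) ≤ Nat.card G * Nat.card H ^ 3 := by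
    have h1 : ∀ x ∈ bad, p ^ (3 * k + 1) * (4 * c x ^ 3) ≤ Nat.card H ^ 3 := by
      intro x hx
      have hx' : k + 1 ≤ Module.finrank (ZMod p) (H ⧸ col x) := (Finset.mem_filter.1 hx).2
      have h2 : c x * p ^ (k + 1) ≤ Nat.card H := by
        rw [← natCard_submodule_mul_pow_finrank_quotient (col x)]
        exact Nat.mul_le_mul_left _ (Nat.pow_le_pow_right (by omega) hx')
      calc p ^ (3 * k + 1) * (4 * c x ^ 3) ≤ p ^ (3 * k + 1) * (p ^ 2 * c x ^ 3) := by
            gcongr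
            nlinarith
        _ = (c x * p ^ (k + 1)) ^ 3 := by ring
        _ ≤ _ := Nat.pow_le_pow_left h2 3
    rw [Finset.mul_sum, Finset.mul_sum]
    refine (Finset.sum_le_card_nsmul _ _ _ h1).trans ?_
    rw [smul_eq_mul, Nat.card_eq_fintype_card (α := G)]
    exact Nat.mul_le_mul_right _ (Finset.card_le_univ _)
  have hbig : 2 * (Nat.card G * Nat.card H ^ 3) ≤ p ^ (3 * k + 1) * ∑ x, c x ^ 3 := by
    calc 2 * (Nat.card G * Nat.card H ^ 3) ≤ p * (p ^ (3 * k) * ∑ x, c x ^ 3) :=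
          Nat.mul_le_mul hp2 hjensen
      _ = _ := by ring
  linarith [mul_comm (Nat.card G) (Nat.card H ^ 3)]

/-- A transverse set with a proper column has density at most `(2 p - 1) / p ^ 2`. -/
theorem sum_card_col_le_of_ne_top [FiniteDimensional (ZMod p) G]
    [FiniteDimensional (ZMod p) H] (hcr : ∀ x y, y ∈ col x ↔ x ∈ row y) {x₀ : G}
    (hx₀ : col x₀ ≠ ⊤) :
    p ^ 2 * ∑ᶠ x, Nat.card (col x) ≤ (2 * p - 1) * (Nat.card G * Nat.card H) := by
  classical
  have := Module.finite_of_finite (ZMod p) (M := G)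
  have := Module.finite_of_finite (ZMod p) (M := H)
  have := Fintype.ofFinite G
  have hp2 : 2 ≤ p := (Fact.out : p.Prime).two_le
  -- `N` consists of the points with full column. It is proper, so the density is at most `1 / p +
  -- (1 - 1 / p) / p`.
  let N : Submodule (ZMod p) G := ⨅ y, row y
  have hN : ∀ x, x ∈ N ↔ col x = ⊤ := by
    intro x
    simp only [N, Submodule.mem_iInf, ← hcr, Submodule.eq_top_iff']
  have hNG : p * Nat.card N ≤ Nat.card G :=
    mul_natCard_le_of_ne_top fun h => hx₀ ((hN x₀).1 (h ▸ Submodule.mem_top))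
  have hbound : ∀ x ∈ (Finset.univ : Finset G), p * Nat.card (col x) ≤
      Nat.card H + if x ∈ N then (p - 1) * Nat.card H else 0 := by
    intro x _
    by_cases hx : x ∈ N
    · rw [if_pos hx, (hN x).1 hx, Nat.card_congr (Submodule.topEquiv (R := ZMod p) (M := H)).toEquiv]
      obtain ⟨q, rfl⟩ : ∃ q, p = q + 1 := ⟨p - 1, by omega⟩
      rw [Nat.add_sub_cancel]
      exact le_of_eq (by ring)
    · rw [if_neg hx, add_zero]
      exact mul_natCard_le_of_ne_top (mt (hN x).2 hx)
  have h1 := Finset.sum_le_sum hbound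
  have hNcard : (Finset.univ.filter fun x => x ∈ N).card = Nat.card N := by
    rw [← Fintype.card_subtype, ← Nat.card_eq_fintype_card]
  rw [← Finset.mul_sum, Finset.sum_add_distrib, Finset.sum_const, ← Finset.sum_filter,
    Finset.sum_const, hNcard, Finset.card_univ, ← Nat.card_eq_fintype_card, smul_eq_mul,
    smul_eq_mul] at h1
  rw [finsum_eq_sum_of_fintype]
  obtain ⟨q, rfl⟩ : ∃ q, p = q + 1 := ⟨p - 1, by omega⟩
  rw [Nat.add_sub_cancel] at h1
  have h2 := Nat.mul_le_mul_left (q + 1) h1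
  have h3 := Nat.mul_le_mul_right (q * Nat.card H) hNG
  have h4 : 2 * (q + 1) - 1 = 2 * q + 1 := by omega
  rw [h4]
  nlinarith

/-- The annihilators of the columns of a transverse set form a subadditive family. -/
theorem isSubadditiveFamily_dualAnnihilator (hcr : ∀ x y, y ∈ col x ↔ x ∈ row y) :
    IsSubadditiveFamily fun x => (col x).dualAnnihilator where
  add_le x y := by
    rw [← Subspace.dualAnnihilator_inf_eq]
    refine Submodule.dualAnnihilator_anti fun h hh => ?_
    rw [hcr]
    exact add_mem ((hcr _ _).1 hh.1) ((hcr _ _).1 hh.2)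
  neg_le x := Submodule.dualAnnihilator_anti fun h hh => by
    rw [hcr]
    exact neg_mem ((hcr _ _).1 hh)

end Restriction

/-! ### From linear covers to bilinear varieties. -/

section Variety

variable {p : ℕ} [Fact p.Prime] {G H : Type*} [AddCommGroup G] [Module (ZMod p) G]
  [FiniteDimensional (ZMod p) G] [AddCommGroup H] [Module (ZMod p) H]
  [FiniteDimensional (ZMod p) H] {col : G → Submodule (ZMod p) H}
  {row : H → Submodule (ZMod p) G}

/-- A transverse set of density at least `p ^ (-k)` contains a bilinear variety with codimensions
`O(k)`, `O(k ^ 2)` and `k`. -/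
theorem exists_bilinearVariety_subset (hcr : ∀ x y, y ∈ col x ↔ x ∈ row y) {k : ℕ} (hk : 1 ≤ k)
    (hdense : Nat.card G * Nat.card H ≤ p ^ k * ∑ᶠ x, Nat.card (col x)) :
    ∃ (U : Submodule (ZMod p) G) (V : Submodule (ZMod p) H) (r : ℕ)
      (β : G →ₗ[ZMod p] H →ₗ[ZMod p] (Fin r → ZMod p)),
      bilinearVariety U V β ⊆ {q | q.2 ∈ col q.1} ∧
      Module.finrank (ZMod p) (G ⧸ U) ≤ 3 * k + 1 ∧
      Module.finrank (ZMod p) (H ⧸ V) ≤ 60 * k ^ 2 ∧ r ≤ k := by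
  have := Module.finite_of_finite (ZMod p) (M := G)
  obtain ⟨U, hU, hbad⟩ := exists_submodule_few_large_codim hcr hdense
  have hB : IsSubadditiveFamily fun x : U => (col x).dualAnnihilator :=
    ⟨fun x y => (isSubadditiveFamily_dualAnnihilator hcr).add_le x y,
      fun x => (isSubadditiveFamily_dualAnnihilator hcr).neg_le x⟩
  have hfr : ∀ x, Module.finrank (ZMod p) (col x).dualAnnihilator =
      Module.finrank (ZMod p) (H ⧸ col x) := by
    intro x
    have h1 := Subspace.finrank_add_finrank_dualAnnihilator_eq (col x)
    have h2 := (col x).finrank_quotient_add_finrank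
    omega
  obtain ⟨F, hF, r, hr, φ, hφ⟩ := hB.exists_linear_cover hk (by simpa only [hfr] using hbad)
  choose ψ hψ using fun i => LinearMap.exists_extend (φ i)
  refine ⟨U, F.dualCoannihilator, r, LinearMap.mk₂ (ZMod p) (fun x y i => ψ i x y) ?_ ?_ ?_ ?_,
    ?_, ?_, ?_, hr⟩
  · intros; ext; simp
  · intros; ext; simp
  · intros; ext; simp
  · intros; ext; simp
  · rintro ⟨x, y⟩ ⟨hx, hy, hxy⟩
    simp only at hx hy hxy
    change y ∈ col x
    -- By duality, `y` is in the column once every functional in its annihilator kills `y`.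
    rw [← Subspace.dualAnnihilator_dualCoannihilator_eq (W := col x),
      Submodule.mem_dualCoannihilator]
    intro f hf
    have h1 := hφ ⟨x, hx⟩ hf
    have h2 : F ⊔ Submodule.span (ZMod p) (Set.range fun i => φ i ⟨x, hx⟩) ≤
        LinearMap.ker (Module.Dual.eval (ZMod p) H y) := by
      refine sup_le (fun g hg => (Submodule.mem_dualCoannihilator y).1 hy g hg) ?_
      rw [Submodule.span_le]
      rintro _ ⟨i, rfl⟩
      have h3 := congrFun hxy i
      have h4 := LinearMap.congr_fun (hψ i) ⟨x, hx⟩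
      change φ i ⟨x, hx⟩ y = 0
      rw [← h4]
      exact h3
    exact h2 h1
  · have h1 := natCard_submodule_mul_pow_finrank_quotient U
    rw [← h1, mul_comm] at hU
    have h2 := Nat.le_of_mul_le_mul_right hU Nat.card_pos
    exact (Nat.pow_le_pow_iff_right (Fact.out : p.Prime).one_lt).1 h2
  · have h1 := Subspace.finrank_add_finrank_dualCoannihilator_eq F
    have h2 := F.dualCoannihilator.finrank_quotient_add_finrank
    omega

end Variety

/-! ### Density, logarithms and the final constants. -/

theorem ncard_eq_finsum_card_col {K G H : Type*} [Field K] [AddCommGroup H] [Module K H]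
    [Finite G] [Finite H] {col : G → Submodule K H} {A : Set (G × H)}
    (hcol : ∀ x y, y ∈ col x ↔ (x, y) ∈ A) : A.ncard = ∑ᶠ x, Nat.card (col x) := by
  have := Fintype.ofFinite G
  rw [finsum_eq_sum_of_fintype, ← Nat.card_sigma, ← Nat.card_coe_set_eq]
  exact Nat.card_congr
    { toFun := fun q => ⟨q.1.1, q.1.2, (hcol _ _).2 q.2⟩
      invFun := fun q => ⟨(q.1, q.2.1), (hcol _ _).1 q.2.2⟩
      left_inv := fun _ => rfl
      right_inv := fun _ => rfl }

/-- The gap below full density: `δ ≤ (2 p - 1) / p ^ 2` forces `log_p δ⁻¹ ≥ 1 / 4`. -/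
theorem quarter_le_logb_inv {p : ℕ} (hp : 2 ≤ p) {δ : ℝ} (hδ : 0 < δ)
    (h : (p : ℝ) ^ 2 * δ ≤ 2 * p - 1) : 1 / 4 ≤ Real.logb p δ⁻¹ := by
  have hp' : (2 : ℝ) ≤ p := by exact_mod_cast hp
  -- The exponent 4 works uniformly in `p`: at `p = 2` this reads `81 ≤ 128`.
  have hpoly : (2 * (p : ℝ) - 1) ^ 4 ≤ (p : ℝ) ^ 7 := by
    rcases hp.eq_or_lt with rfl | h3
    · norm_num
    · have h3' : (3 : ℝ) ≤ p := by exact_mod_cast h3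
      calc (2 * (p : ℝ) - 1) ^ 4 ≤ (2 * (p : ℝ)) ^ 4 := by gcongr <;> linarith
        _ = 16 * (p : ℝ) ^ 4 := by ring
        _ ≤ (p : ℝ) ^ 3 * (p : ℝ) ^ 4 := by
          gcongr
          calc (16 : ℝ) ≤ 3 ^ 3 := by norm_num
            _ ≤ _ := by gcongr
        _ = _ := by ring
  have h1 : ((p : ℝ) ^ 2 * δ) ^ 4 ≤ p ^ 7 := (by gcongr : _ ≤ (2 * (p : ℝ) - 1) ^ 4).trans hpoly
  have h2 : (p : ℝ) * δ ^ 4 ≤ 1 := by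
    have h3 : (0 : ℝ) < p ^ 7 := by positivity
    refine le_of_mul_le_mul_left ?_ h3
    calc (p : ℝ) ^ 7 * (p * δ ^ 4) = (p ^ 2 * δ) ^ 4 := by ring
      _ ≤ _ := by rw [mul_one]; exact h1
  have h4 : (p : ℝ) ≤ δ⁻¹ ^ 4 := by
    rw [inv_pow, ← one_div]
    exact (le_div_iff₀ (by positivity)).2 h2
  have h5 := Real.logb_le_logb_of_le (by linarith : (1 : ℝ) < p) (by positivity) h4
  rw [Real.logb_self_eq_one (by linarith), Real.logb_pow] at h5
  push_cast at h5
  linarith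

theorem mainTheorem1 :
    ∃ C : ℝ, 0 < C ∧
      ∀ (p : ℕ) [Fact p.Prime] (G H : Type*)
        [AddCommGroup G] [Module (ZMod p) G] [FiniteDimensional (ZMod p) G]
        [AddCommGroup H] [Module (ZMod p) H] [FiniteDimensional (ZMod p) H]
        (A : Set (G × H)) (δ : ℝ),
        0 < δ → IsTransverse (ZMod p) A →
        δ * (Nat.card G : ℝ) * (Nat.card H : ℝ) ≤ (A.ncard : ℝ) →
        ∃ (U : Submodule (ZMod p) G) (V : Submodule (ZMod p) H) (r : ℕ)
          (β : G →ₗ[ZMod p] H →ₗ[ZMod p] (Fin r → ZMod p)),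
          bilinearVariety U V β ⊆ A ∧
          (Module.finrank (ZMod p) (G ⧸ U) : ℝ) ≤ C * Real.logb p δ⁻¹ ^ 3 ∧
          (Module.finrank (ZMod p) (H ⧸ V) : ℝ) ≤ C * Real.logb p δ⁻¹ ^ 2 ∧
          (r : ℝ) ≤ C * Real.logb p δ⁻¹ := by
  -- `1500 = 60 * 5 ^ 2`, from `60 * k ^ 2` and `k ≤ 5 * t`.
  refine ⟨1500, by norm_num, ?_⟩
  intro p _ G H _ _ _ _ _ _ A δ hδ hA hdens
  have := Module.finite_of_finite (ZMod p) (M := G)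
  have := Module.finite_of_finite (ZMod p) (M := H)
  have hp2 : 2 ≤ p := (Fact.out : p.Prime).two_le
  have hp1 : (1 : ℝ) < p := by exact_mod_cast hp2
  obtain ⟨hA1, hA2⟩ := hA
  choose col hcol' using hA1
  choose row hrow' using hA2
  have hcol : ∀ x y, y ∈ col x ↔ (x, y) ∈ A := fun x y => by
    rw [← SetLike.mem_coe, hcol']; rfl
  have hrow : ∀ x y, x ∈ row y ↔ (x, y) ∈ A := fun x y => by
    rw [← SetLike.mem_coe, hrow']; rfl
  have hcr : ∀ x y, y ∈ col x ↔ x ∈ row y := fun x y => (hcol x y).trans (hrow x y).symm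
  have hG : (0 : ℝ) < Nat.card G := by exact_mod_cast Nat.card_pos
  have hH : (0 : ℝ) < Nat.card H := by exact_mod_cast Nat.card_pos
  have hGH : (0 : ℝ) < Nat.card G * Nat.card H := mul_pos hG hH
  rw [mul_assoc] at hdens
  by_cases hall : ∀ x, col x = ⊤
  -- The logarithm may vanish here, so all codimensions and `r` must be 0.
  · have hle : (A.ncard : ℝ) ≤ Nat.card G * Nat.card H := by
      rw [← Nat.cast_mul, ← Nat.card_prod]
      exact_mod_cast Set.ncard_le_card A
    have hδ1 : δ ≤ 1 := by
      refine le_of_mul_le_mul_right ?_ hGH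
      rw [one_mul]
      exact hdens.trans hle
    have hlog : 0 ≤ Real.logb p δ⁻¹ := Real.logb_nonneg hp1 ((one_le_inv₀ hδ).2 hδ1)
    refine ⟨⊤, ⊤, 0, 0, fun q _ => (hcol q.1 q.2).1 (hall q.1 ▸ Submodule.mem_top), ?_, ?_, ?_⟩
    · rw [Module.finrank_zero_of_subsingleton, Nat.cast_zero]
      positivity
    · rw [Module.finrank_zero_of_subsingleton, Nat.cast_zero]
      positivity
    · rw [Nat.cast_zero]
      positivity
  · obtain ⟨x₀, hx₀⟩ := not_forall.1 hall
    rw [ncard_eq_finsum_card_col hcol] at hdens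
    set S := ∑ᶠ x, Nat.card (col x)
    set t := Real.logb p δ⁻¹
    have ht4 : 1 / 4 ≤ t := by
      refine quarter_le_logb_inv hp2 hδ ?_
      have h1 : (p : ℝ) ^ 2 * S ≤ (2 * p - 1) * (Nat.card G * Nat.card H) := by
        have h2 := sum_card_col_le_of_ne_top hcr hx₀
        have h3 : ((2 * p - 1 : ℕ) : ℝ) = 2 * p - 1 := by
          rw [Nat.cast_sub (by omega)]; push_cast; ring
        rw [← h3]
        exact_mod_cast h2
      refine le_of_mul_le_mul_right ?_ hGH
      rw [mul_assoc]
      exact (mul_le_mul_of_nonneg_left hdens (by positivity)).trans h1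
    have hk1 : 1 ≤ ⌈t⌉₊ := Nat.one_le_ceil_iff.2 (by linarith)
    have hk5 : (⌈t⌉₊ : ℝ) ≤ 5 * t := by
      have := Nat.ceil_lt_add_one (show 0 ≤ t by linarith)
      linarith
    have hpk : 1 ≤ (p : ℝ) ^ ⌈t⌉₊ * δ := by
      have h1 : δ⁻¹ ≤ (p : ℝ) ^ ⌈t⌉₊ := by
        rw [← Real.rpow_natCast, ← Real.logb_le_iff_le_rpow hp1 (inv_pos.2 hδ)]
        exact Nat.le_ceil t
      calc 1 = δ⁻¹ * δ := (inv_mul_cancel₀ hδ.ne').symm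
        _ ≤ _ := by gcongr
    have hdense : Nat.card G * Nat.card H ≤ p ^ ⌈t⌉₊ * S := by
      have h1 : (Nat.card G * Nat.card H : ℝ) ≤ p ^ ⌈t⌉₊ * S := by
        calc (Nat.card G * Nat.card H : ℝ) ≤ (p ^ ⌈t⌉₊ * δ) * (Nat.card G * Nat.card H) :=
              le_mul_of_one_le_left hGH.le hpk
          _ = p ^ ⌈t⌉₊ * (δ * (Nat.card G * Nat.card H)) := by ring
          _ ≤ _ := by gcongr
      exact_mod_cast h1
    obtain ⟨U, V, r, β, hsub, hUc, hVc, hr⟩ := exists_bilinearVariety_subset hcr hk1 hdense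
    have hk1' : (1 : ℝ) ≤ ⌈t⌉₊ := by exact_mod_cast hk1
    refine ⟨U, V, r, β, fun q hq => (hcol q.1 q.2).1 (hsub hq), ?_, ?_, ?_⟩
    · have h1 : (Module.finrank (ZMod p) (G ⧸ U) : ℝ) ≤ 3 * ⌈t⌉₊ + 1 := by exact_mod_cast hUc
      -- The codimension of `U` is in fact linear in `t`; `t ≥ 1 / 4` turns this into the cubic
      -- bound.
      have h2 : 1 / 16 * t ≤ t ^ 2 * t := by
        gcongr
        nlinarith
      calc _ ≤ 20 * t := by linarith
        _ ≤ 1500 * t ^ 3 := by linarith [pow_succ t 2]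
    · have h1 : (Module.finrank (ZMod p) (H ⧸ V) : ℝ) ≤ 60 * ⌈t⌉₊ ^ 2 := by exact_mod_cast hVc
      calc _ ≤ 60 * (⌈t⌉₊ : ℝ) ^ 2 := h1
        _ ≤ 60 * (5 * t) ^ 2 := by gcongr
        _ = 1500 * t ^ 2 := by ring
    · have h1 : (r : ℝ) ≤ ⌈t⌉₊ := by exact_mod_cast hr
      linarith
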